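/- All graphs are simple (undirected, without loops), and subgraphs are induced. A homomorphism between graphs is a map of vertices that sends adjacent vertices to adjacent vertices; a monomorphism is an injective homomorphism; an epimorphism of a graph $G$ is a homomorphism $G\to G$ that is surjective on vertices. A graph $G$ is called ME-homogeneous if every monomorphism $f\colon A\to B$ between finite induced subgraphs $A,B$ of $G$ is the restriction of an epimorphism of $G$ (that is, there is an epimorphism $F\colon G\to G$ with $F(a)=f(a)$ for all $a\in A$), and HE-homogeneous if every homomorphism between finite induced subgraphs of $G$ is the restriction of an epimorphism of $G$. **Theorem.** Let $G$ be a countably infinite graph. Then $G$ is ME-homogeneous if and only if it is HE-homogeneous. -/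

import Mathlib

namespace SimpleGraph

/-- Every monomorphism (injective homomorphism) between finite induced subgraphs of `G`
is the restriction of an epimorphism (surjective endomorphism) of `G`. -/
def IsMEHomogeneous {V : Type*} (G : SimpleGraph V) : Prop :=
  ∀ A B : Set V, A.Finite → B.Finite → ∀ f : G.induce A →g G.induce B,
    Function.Injective f →
      ∃ F : G →g G, Function.Surjective F ∧ ∀ a : A, F (a : V) = (f a : V)

/-- Every homomorphism between finite induced subgraphs of `G`
is the restriction of an epimorphism (surjective endomorphism) of `G`. -/
def IsHEHomogeneous {V : Type*} (G : SimpleGraph V) : Prop :=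
  ∀ A B : Set V, A.Finite → B.Finite → ∀ f : G.induce A →g G.induce B,
    ∃ F : G →g G, Function.Surjective F ∧ ∀ a : A, F (a : V) = (f a : V)

end SimpleGraph

/-!
ME-homogeneity trivially follows from HE-homogeneity. Conversely, let `G` be ME-homogeneous. As `G`
is countable, a back-and-forth construction reduces the claim to one-point extensions of a
homomorphism `f` from a finite induced subgraph `A`.

Forth (`IsMEHomogeneous.exists_forth`): to extend `f` to a vertex `v`, restrict `f` to a transversal
of its fibres on the neighbours of `v` in `A`. This restriction is a monomorphism with the same
image on these neighbours, so the value at `v` of an epimorphism extending it will do.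

Back (`IsMEHomogeneous.exists_back`): to bring a vertex `w` into the image one needs a vertex
outside `A` and far from the set `T` of those `a ∈ A` with `f a` not adjacent to `w`; here "far from `T`"
means outside `T` and adjacent to no vertex of `T`. By ME-homogeneity, monomorphisms preserve
dominating sets (sets from which no vertex is far), see `IsMEHomogeneous.far_nonempty_of_hom`.
Complete graphs pose no problem.

* If some finite set has no common neighbour, neighbourhoods contain only independent sets of
  bounded size, while `G` has independent sets of every size, so infinitely many vertices are far
  from any given finite set (`IsMEHomogeneous.far_infinite_of_not_hasCommonNeighbors`).
* Otherwise the set of vertices far from a finite set is empty or infinite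
  (`IsMEHomogeneous.far_infinite`), so only dominating sets `T` have to be excluded. Let `m + 1` be
  the least size of a dominating set, if there is one. All cliques of this size dominate. The main
  step, `IsDominationThreshold.far_nonempty_of_coloring`, shows that `m`-colourable finite sets do
  not dominate. For `m ≥ 2` this leads to a contradiction (`IsDominationThreshold.eq_one`): choosing
  a vertex far from each `m`-subset of a clique with `2 * m - 1` vertices, one can build a star that
  is dominating, although stars are `2`-colourable. So `m = 1` and all edges dominate. Then
  `f '' T`, being far from `w`, is independent, hence so is `T`, and `T` is not dominating.
-/

namespace SimpleGraph

variable {V : Type*} {G : SimpleGraph V}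

/-! ### Extending maps of vertices to epimorphisms -/

/-- ME-homogeneity for a map given on all vertices of which only the values on `T` matter. -/
theorem IsMEHomogeneous.exists_epi (hG : G.IsMEHomogeneous) {T : Set V} (hT : T.Finite)
    {f : V → V} (hinj : T.InjOn f) (hf : ∀ a ∈ T, ∀ b ∈ T, G.Adj a b → G.Adj (f a) (f b)) :
    ∃ F : G →g G, Function.Surjective F ∧ ∀ a ∈ T, F a = f a := by
  obtain ⟨F, hF, hFf⟩ := hG T (f '' T) hT (hT.image f)
    ⟨fun a => ⟨f a, a, a.2, rfl⟩, fun {a b} hab => hf a a.2 b b.2 hab⟩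
    (fun a b hab => Subtype.ext (hinj a.2 b.2 (congrArg Subtype.val hab)))
  exact ⟨F, hF, fun a ha => hFf ⟨a, ha⟩⟩

/-- The vertices outside `T` that are adjacent to no vertex of `T`. Thus `T` is a dominating set
exactly when `G.far T` is empty. -/
def far (G : SimpleGraph V) (T : Set V) : Set V := {v | v ∉ T ∧ ∀ t ∈ T, ¬G.Adj v t}

theorem far_anti {S T : Set V} (h : S ⊆ T) : G.far T ⊆ G.far S :=
  fun _ hv => ⟨fun hS => hv.1 (h hS), fun t ht => hv.2 t (h ht)⟩

/-- A dominating set stays dominating under monomorphisms. The monomorphism is given by two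
parametrizations `h`, `h'` of its source and its target. -/
theorem IsMEHomogeneous.far_nonempty_of_hom (hG : G.IsMEHomogeneous) {ι : Type*} {S : Set ι}
    (hS : S.Finite) {h h' : ι → V} (hh : S.InjOn h) (hh' : S.InjOn h')
    (hom : ∀ a ∈ S, ∀ b ∈ S, G.Adj (h a) (h b) → G.Adj (h' a) (h' b))
    (hfar : (G.far (h' '' S)).Nonempty) : (G.far (h '' S)).Nonempty := by
  obtain ⟨w, hwS, hw⟩ := hfar
  rcases S.eq_empty_or_nonempty with rfl | ⟨s, hs⟩
  · exact ⟨w, by simp, by simp⟩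
  have : Nonempty ι := ⟨s⟩
  have hinv : ∀ a ∈ S, Function.invFunOn h S (h a) = a := fun a ha =>
    hh.leftInvOn_invFunOn ha
  obtain ⟨F, hF, hFf⟩ := hG.exists_epi (hS.image h) (f := h' ∘ Function.invFunOn h S)
    (by
      rintro _ ⟨a, ha, rfl⟩ _ ⟨b, hb, rfl⟩ hab
      simp only [Function.comp, hinv a ha, hinv b hb] at hab
      rw [hh' ha hb hab])
    (by
      rintro _ ⟨a, ha, rfl⟩ _ ⟨b, hb, rfl⟩ hab
      simpa only [Function.comp, hinv a ha, hinv b hb] using hom a ha b hb hab)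
  have hFS : ∀ a ∈ S, F (h a) = h' a := fun a ha => by
    simpa [hinv a ha] using hFf (h a) ⟨a, ha, rfl⟩
  obtain ⟨v, rfl⟩ := hF w
  refine ⟨v, ?_, ?_⟩
  · rintro ⟨a, ha, rfl⟩
    exact hwS ⟨a, ha, (hFS a ha).symm⟩
  · rintro _ ⟨a, ha, rfl⟩ hadj
    exact hw _ ⟨a, ha, rfl⟩ (hFS a ha ▸ F.map_adj hadj)

/-- Every finite set of vertices has a common neighbour. -/
def HasCommonNeighbors (G : SimpleGraph V) : Prop :=
  ∀ D : Set V, D.Finite → ∃ v, ∀ d ∈ D, G.Adj v d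

theorem exists_injOn_of_card_le {α β : Type*} [Nonempty β] {s : Finset α} {t : Finset β}
    (h : s.card ≤ t.card) : ∃ f : α → β, (∀ a ∈ s, f a ∈ t) ∧ Set.InjOn f s := by
  obtain ⟨f, hf, hinj⟩ := s.finite_toSet.exists_injOn_of_encard_le (t := (t : Set β))
    (by simpa [Set.encard_coe_eq_coe_finsetCard] using h)
  exact ⟨f, fun a ha => by simpa using hf ha, hinj⟩

/-! ### Graphs without common neighbours -/

/-- If finite sets need not have common neighbours, neighbourhoods contain only independent sets
of bounded size: an independent set can be mapped onto any set of the same size, and its common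
neighbours go to common neighbours. -/
theorem IsMEHomogeneous.exists_card_lt (hG : G.IsMEHomogeneous) (hc : ¬G.HasCommonNeighbors) :
    ∃ N : ℕ, ∀ (x : V) (I : Finset V), G.IsIndepSet (I : Set V) → (∀ a ∈ I, G.Adj x a) →
      I.card < N := by
  classical
  simp only [HasCommonNeighbors, not_forall, not_exists] at hc
  obtain ⟨D, hD, hDc⟩ := hc
  lift D to Finset V using hD
  refine ⟨D.card, fun x I hI hx => ?_⟩
  by_contra! hle
  obtain ⟨J, hJI, hJ⟩ := Finset.exists_subset_card_eq hle
  have : Nonempty V := ⟨x⟩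
  obtain ⟨f, hfD, hf⟩ := exists_injOn_of_card_le hJ.le
  obtain ⟨F, -, hF⟩ := hG.exists_epi J.finite_toSet hf
    (fun a ha b hb hab => absurd hab (hI (hJI ha) (hJI hb) hab.ne))
  obtain ⟨d, hd, hnd⟩ := hDc (F x)
  have him : J.image f = D :=
    Finset.eq_of_subset_of_card_le (Finset.image_subset_iff.2 hfD)
      (by rw [Finset.card_image_of_injOn hf, hJ])
  obtain ⟨a, ha, rfl⟩ := Finset.mem_image.1 (him ▸ Finset.mem_coe.1 hd)
  exact hnd (hF a ha ▸ F.map_adj (hx a (hJI ha)))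

/-- If the independent sets have bounded size, the largest ones are dominating, hence so are all
sets of that size. Then vertices have finitely many non-neighbours, which yields common
neighbours. -/
theorem IsMEHomogeneous.exists_isIndepSet [Infinite V] (hG : G.IsMEHomogeneous)
    (hc : ¬G.HasCommonNeighbors) (k : ℕ) :
    ∃ I : Finset V, G.IsIndepSet (I : Set V) ∧ I.card = k := by
  classical
  induction k with
  | zero => exact ⟨∅, by simp [IsIndepSet], rfl⟩
  | succ m ih =>
    obtain ⟨I, hI, rfl⟩ := ih
    by_contra hno
    have hIfar : ¬(G.far (I : Set V)).Nonempty := by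
      rintro ⟨v, hvI, hv⟩
      refine hno ⟨insert v I, ?_, Finset.card_insert_of_notMem (by simpa using hvI)⟩
      rw [Finset.coe_insert, IsIndepSet]
      exact hI.insert fun b hb _ => ⟨hv b hb, fun h => hv b hb h.symm⟩
    have hfin : ∀ u, (G.far {u}).Finite := by
      intro u
      by_contra hinf
      obtain ⟨T, hT, hTc⟩ := Set.Infinite.exists_subset_card_eq hinf I.card
      have : Nonempty V := ⟨u⟩
      obtain ⟨f, hfT, hf⟩ := exists_injOn_of_card_le hTc.ge
      refine hIfar ?_
      rw [← Set.image_id (I : Set V)]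
      refine hG.far_nonempty_of_hom I.finite_toSet (Set.injOn_id _) hf
        (fun a ha b hb hab => absurd hab (hI ha hb hab.ne)) ⟨u, ?_, ?_⟩
      · rintro ⟨a, ha, hau⟩
        exact (hT (hfT a ha)).1 hau
      · rintro _ ⟨a, ha, rfl⟩ hadj
        exact (hT (hfT a ha)).2 u rfl hadj.symm
    refine hc fun D hD => ?_
    obtain ⟨v, hv⟩ := (hD.biUnion (t := fun d => insert d (G.far {d}))
      fun d _ => (hfin d).insert d).exists_notMem
    refine ⟨v, fun d hd => ?_⟩
    by_contra hvd
    refine hv (Set.mem_biUnion hd ?_)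
    by_cases h : v = d
    · exact Or.inl h
    · exact Or.inr ⟨h, by rintro _ rfl; exact hvd⟩

/-- Each vertex of `T` has a bounded number of neighbours in an independent set, however large. -/
theorem IsMEHomogeneous.far_infinite_of_not_hasCommonNeighbors [Infinite V]
    (hG : G.IsMEHomogeneous) (hc : ¬G.HasCommonNeighbors) (T : Finset V) :
    (G.far (T : Set V)).Infinite := by
  classical
  intro hfin
  obtain ⟨N, hN⟩ := hG.exists_card_lt hc
  obtain ⟨I, hI, hIc⟩ := hG.exists_isIndepSet hc (T.card + hfin.toFinset.card + T.card * N + 1)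
  have hsub : I ⊆ T ∪ hfin.toFinset ∪ T.biUnion fun t => I.filter (G.Adj t) := by
    intro v hv
    by_contra h
    simp only [Finset.mem_union, Set.Finite.mem_toFinset, Finset.mem_biUnion, Finset.mem_filter,
      not_or, not_exists, not_and] at h
    exact h.1.2 ⟨by simpa using h.1.1, fun t ht hadj => h.2 t ht hv hadj.symm⟩
  have h1 := Finset.card_le_card hsub
  have h2 : (T.biUnion fun t => I.filter (G.Adj t)).card ≤ T.card * N :=
    Finset.card_biUnion_le_card_mul _ _ _ fun t _ =>
      (hN t _ (hI.mono (Finset.coe_subset.2 (Finset.filter_subset _ _))) (by simp)).le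
  have h3 := Finset.card_union_le (T ∪ hfin.toFinset) (T.biUnion fun t => I.filter (G.Adj t))
  have h4 := Finset.card_union_le T hfin.toFinset
  omega

/-! ### Cliques and independent sets in graphs with common neighbours -/

theorem HasCommonNeighbors.exists_clique (hc : G.HasCommonNeighbors) {ι : Type*} (S : Finset ι)
    {D : Set V} (hD : D.Finite) :
    ∃ z : ι → V, (∀ a ∈ S, ∀ b ∈ S, a ≠ b → G.Adj (z a) (z b)) ∧
      ∀ a ∈ S, ∀ d ∈ D, G.Adj (z a) d := by
  classical
  induction S using Finset.induction_on with
  | empty => exact ⟨fun _ => (hc ∅ Set.finite_empty).choose, by simp, by simp⟩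
  | insert i S hi ih =>
    obtain ⟨z, hz, hzD⟩ := ih
    obtain ⟨v, hv⟩ := hc (D ∪ z '' S) (hD.union (S.finite_toSet.image z))
    have hne : ∀ a ∈ S, a ≠ i := fun a ha h => hi (h ▸ ha)
    have hvS : ∀ a ∈ S, G.Adj v (z a) := fun a ha => hv _ (Or.inr ⟨a, ha, rfl⟩)
    refine ⟨Function.update z i v, ?_, ?_⟩
    · intro a ha b hb hab
      rcases Finset.mem_insert.1 ha with rfl | ha' <;>
        rcases Finset.mem_insert.1 hb with rfl | hb'
      · exact absurd rfl hab
      · simpa [hne b hb'] using hvS b hb'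
      · simpa [hne a ha'] using (hvS a ha').symm
      · simpa [hne a ha', hne b hb'] using hz a ha' b hb' hab
    · intro a ha d hd
      rcases Finset.mem_insert.1 ha with rfl | ha
      · simpa using hv d (Or.inl hd)
      · simpa [hne a ha] using hzD a ha d hd

theorem injOn_of_adj {ι : Type*} {S : Set ι} {z : ι → V}
    (h : ∀ a ∈ S, ∀ b ∈ S, a ≠ b → G.Adj (z a) (z b)) : S.InjOn z :=
  fun a ha b hb hab => by_contra fun hne => (h a ha b hb hne).ne hab

/-- An infinite set of vertices without cliques of size `n` contains independent sets of every
size. -/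
theorem exists_isIndepSet_of_infinite (n : ℕ) {Y : Set V} (hY : Y.Infinite)
    (hn : ∀ K : Finset V, (K : Set V) ⊆ Y → ¬G.IsNClique n K) (k : ℕ) :
    ∃ I : Finset V, (I : Set V) ⊆ Y ∧ G.IsIndepSet (I : Set V) ∧ I.card = k := by
  classical
  induction n generalizing Y with
  | zero => exact absurd (by simp) (hn ∅ (by simp))
  | succ n ih =>
    by_cases hdeg : ∃ y ∈ Y, (Y ∩ G.neighborSet y).Infinite
    · obtain ⟨y, hyY, hy⟩ := hdeg
      obtain ⟨I, hIY, hI⟩ := ih hy fun K hK hKn =>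
        hn (insert y K)
          (by
            rw [Finset.coe_insert]
            exact Set.insert_subset hyY (hK.trans Set.inter_subset_left))
          (hKn.insert fun b hb => (hK hb).2)
      exact ⟨I, hIY.trans Set.inter_subset_left, hI⟩
    · push Not at hdeg
      clear ih
      -- all degrees inside `Y` are finite: choose greedily
      induction k with
      | zero => exact ⟨∅, by simp, by simp [IsIndepSet], rfl⟩
      | succ k ihk =>
        obtain ⟨I, hIY, hI, rfl⟩ := ihk
        have hfin : (⋃ a ∈ (I : Set V), insert a (Y ∩ G.neighborSet a)).Finite :=
          I.finite_toSet.biUnion fun a ha => (hdeg a (hIY ha)).insert a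
        obtain ⟨v, hvY, hv⟩ := hY.exists_notMem_finite hfin
        have hvI : ∀ a ∈ I, v ≠ a ∧ ¬G.Adj a v := fun a ha =>
          ⟨fun h => hv (Set.mem_biUnion ha (Or.inl h)),
            fun h => hv (Set.mem_biUnion ha (Or.inr ⟨hvY, h⟩))⟩
        refine ⟨insert v I, ?_, ?_,
          Finset.card_insert_of_notMem fun h => (hvI v h).1 rfl⟩
        · rw [Finset.coe_insert]
          exact Set.insert_subset hvY hIY
        · rw [Finset.coe_insert, IsIndepSet]
          exact hI.insert fun b hb _ => ⟨fun h => (hvI b hb).2 h.symm, (hvI b hb).2⟩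

/-- In the presence of common neighbours, `G.far T` is empty or infinite: fix `T` and move a
finite nonempty `G.far T` onto a clique of common neighbours; no vertex can then be mapped onto
an element of `G.far T`. -/
theorem IsMEHomogeneous.far_infinite (hG : G.IsMEHomogeneous) (hc : G.HasCommonNeighbors)
    {T : Set V} (hT : T.Finite) (hfar : (G.far T).Nonempty) : (G.far T).Infinite := by
  classical
  intro hfin
  obtain ⟨u, hu⟩ := hfar
  obtain ⟨z, hz, hzD⟩ := hc.exists_clique hfin.toFinset (hT.union hfin)
  simp only [Set.Finite.mem_toFinset] at hz hzD
  have hout : ∀ a, a ∉ T → a ∈ T ∪ G.far T → a ∈ G.far T := fun a h h' => h'.resolve_left h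
  obtain ⟨F, hF, hFf⟩ := hG.exists_epi (hT.union hfin) (f := fun a => if a ∈ T then a else z a)
    (by
      intro a ha b hb hab
      by_cases haT : a ∈ T <;> by_cases hbT : b ∈ T <;> simp only [haT, hbT, if_true, if_false]
        at hab
      · exact hab
      · exact absurd hab.symm (hzD b (hout b hbT hb) a ha).ne
      · exact absurd hab (hzD a (hout a haT ha) b hb).ne
      · exact injOn_of_adj (S := G.far T) hz (hout a haT ha) (hout b hbT hb) hab)
    (by
      intro a ha b hb hab
      by_cases haT : a ∈ T <;> by_cases hbT : b ∈ T <;> simp only [haT, hbT, if_true, if_false]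
      · exact hab
      · exact (hzD b (hout b hbT hb) a ha).symm
      · exact hzD a (hout a haT ha) b hb
      · exact hz a (hout a haT ha) b (hout b hbT hb) hab.ne)
  have hFT : ∀ a ∈ T, F a = a := fun a ha => by simpa [ha] using hFf a (Or.inl ha)
  obtain ⟨v, rfl⟩ := hF u
  by_cases hvT : v ∈ T
  · exact hu.1 (by rwa [hFT v hvT])
  · by_cases hvf : v ∈ G.far T
    · have h1 : F v = z v := by simpa [hvT] using hFf v (Or.inr hvf)
      exact (hzD v hvf _ (Or.inr hu)).ne h1.symm
    · obtain ⟨t, ht, hvt⟩ : ∃ t ∈ T, G.Adj v t := by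
        by_contra! h
        exact hvf ⟨hvT, h⟩
      exact hu.2 t ht (by simpa [hFT t ht] using F.map_adj hvt)

/-! ### Graphs in which cliques of some size dominate -/

/-- No set of at most `m` vertices is dominating, whereas all cliques with `m + 1` vertices are;
`m = 0` is excluded. -/
structure IsDominationThreshold (G : SimpleGraph V) (m : ℕ) : Prop where
  pos : 0 < m
  far_nonempty : ∀ T : Finset V, T.card ≤ m → (G.far (T : Set V)).Nonempty
  far_clique : ∀ K : Finset V, G.IsNClique (m + 1) K → G.far (K : Set V) = ∅

namespace IsDominationThreshold

variable {m : ℕ}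

/-- The common neighbours of an `m`-clique `B` are adjacent to all of `G.far B`. -/
theorem adj_of_mem_far (hm : G.IsDominationThreshold m) {B : Finset V} (hB : G.IsNClique m B)
    {x v : V} (hx : ∀ b ∈ B, G.Adj x b) (hv : v ∈ G.far (B : Set V)) : G.Adj v x := by
  classical
  obtain ⟨b, hb⟩ : B.Nonempty := Finset.card_pos.1 (hB.card_eq ▸ hm.pos)
  have hvx : v ≠ x := by
    rintro rfl
    exact hv.2 b hb (hx b hb)
  by_contra hadj
  have : v ∈ G.far ((insert x B : Finset V) : Set V) := by
    refine ⟨?_, ?_⟩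
    · simpa [hvx] using hv.1
    · simpa [hadj] using hv.2
  rw [hm.far_clique _ (hB.insert hx)] at this
  exact this

theorem exists_isIndepSet_far (hm : G.IsDominationThreshold m) (hG : G.IsMEHomogeneous)
    (hc : G.HasCommonNeighbors) {T : Set V} (hT : T.Finite) (hne : T.Nonempty)
    (hfar : (G.far T).Nonempty) (k : ℕ) :
    ∃ I : Finset V, (I : Set V) ⊆ G.far T ∧ G.IsIndepSet (I : Set V) ∧ I.card = k := by
  obtain ⟨t, ht⟩ := hne
  refine exists_isIndepSet_of_infinite (m + 1) (hG.far_infinite hc hT hfar) (fun K hK hKn => ?_) k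
  have : t ∈ G.far (K : Set V) :=
    ⟨fun h => (hK h).1 ht, fun a ha hadj => (hK ha).2 t ht hadj.symm⟩
  rw [hm.far_clique K hKn] at this
  exact this

/-- Take an `m`-clique `B` of common neighbours of `D` and an independent set in `G.far B`. -/
theorem exists_isIndepSet_adj (hm : G.IsDominationThreshold m) (hG : G.IsMEHomogeneous)
    (hc : G.HasCommonNeighbors) {D : Set V} (hD : D.Finite) (k : ℕ) :
    ∃ I : Finset V, G.IsIndepSet (I : Set V) ∧ I.card = k ∧ ∀ v ∈ I, ∀ d ∈ D, G.Adj v d := by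
  classical
  obtain ⟨z, hz, hzD⟩ := hc.exists_clique (Finset.range m) hD
  have hinj : Set.InjOn z (Finset.range m : Set ℕ) := injOn_of_adj hz
  have hB : G.IsNClique m ((Finset.range m).image z) := by
    refine ⟨?_, by rw [Finset.card_image_of_injOn hinj, Finset.card_range]⟩
    rw [Finset.coe_image]
    rintro _ ⟨a, ha, rfl⟩ _ ⟨b, hb, rfl⟩ hab
    exact hz a ha b hb fun h => hab (h ▸ rfl)
  obtain ⟨I, hIf, hI, hIk⟩ := hm.exists_isIndepSet_far hG hc (Finset.finite_toSet _)
    (Finset.coe_nonempty.2 (Finset.card_pos.1 (hB.card_eq.symm ▸ hm.pos)))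
    (hm.far_nonempty _ hB.card_eq.le) k
  refine ⟨I, hI, hIk, fun v hv d hd => hm.adj_of_mem_far hB ?_ (hIf hv)⟩
  intro b hb
  obtain ⟨a, ha, rfl⟩ := Finset.mem_image.1 hb
  exact (hzD a ha d hd).symm

/-- Every finite complete multipartite graph, with parts the fibres of a colouring `c` of `S`,
embeds into the set of common neighbours of a finite set `D`. -/
theorem exists_multipartite (hm : G.IsDominationThreshold m) (hG : G.IsMEHomogeneous)
    (hc : G.HasCommonNeighbors) {ι κ : Type*} (S : Finset ι) (c : ι → κ) {D : Set V}
    (hD : D.Finite) :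
    ∃ z : ι → V, Set.InjOn z S ∧ (∀ a ∈ S, ∀ b ∈ S, G.Adj (z a) (z b) ↔ c a ≠ c b) ∧
      ∀ a ∈ S, ∀ d ∈ D, G.Adj (z a) d := by
  classical
  have : Nonempty V := ⟨(hc ∅ Set.finite_empty).choose⟩
  induction S using Finset.strongInduction with
  | H S ih =>
    rcases S.eq_empty_or_nonempty with rfl | ⟨s, hs⟩
    · exact ⟨fun _ => this.some, by simp, by simp, by simp⟩
    obtain ⟨z, hzinj, hz, hzD⟩ := ih (S.filter fun a => c a ≠ c s)
      (Finset.filter_ssubset.2 ⟨s, hs, by simp⟩)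
    obtain ⟨I, hI, hIk, hIz⟩ := hm.exists_isIndepSet_adj hG hc
      (hD.union ((S.filter fun a => c a ≠ c s).finite_toSet.image z)) (S.card)
    obtain ⟨g, hgI, hg⟩ := exists_injOn_of_card_le hIk.ge
    have hmem : ∀ a ∈ S, c a ≠ c s → a ∈ S.filter fun a => c a ≠ c s := fun a ha h =>
      Finset.mem_filter.2 ⟨ha, h⟩
    have hgz : ∀ a ∈ S, ∀ b ∈ S, c b ≠ c s → G.Adj (g a) (z b) := fun a ha b hb hcb =>
      hIz _ (hgI a ha) _ (Or.inr ⟨b, hmem b hb hcb, rfl⟩)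
    refine ⟨fun a => if c a = c s then g a else z a, ?_, ?_, ?_⟩
    · intro a ha b hb hab
      by_cases hca : c a = c s <;> by_cases hcb : c b = c s <;>
        simp only [hca, hcb, if_true, if_false] at hab
      · exact hg ha hb hab
      · exact absurd hab (hgz a ha b hb hcb).ne
      · exact absurd hab.symm (hgz b hb a ha hca).ne
      · exact hzinj (hmem a ha hca) (hmem b hb hcb) hab
    · intro a ha b hb
      by_cases hca : c a = c s <;> by_cases hcb : c b = c s <;>
        simp only [hca, hcb, if_true, if_false]
      · simpa using fun h => hI (hgI a ha) (hgI b hb) h.ne h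
      · exact iff_of_true (hgz a ha b hb hcb) (Ne.symm hcb)
      · exact iff_of_true (hgz b hb a ha hca).symm hca
      · exact hz a (hmem a ha hca) b (hmem b hb hcb)
    · intro a ha d hd
      by_cases hca : c a = c s <;> simp only [hca, if_true, if_false]
      · exact hIz _ (hgI a ha) _ (Or.inl hd)
      · exact hzD a (hmem a ha hca) d hd

/-- A finite set that is properly coloured with at most `m` colours is not dominating.

The set is given as an image `h '' S`, and one may assume the claim for sets with fewer elements.
If the colouring is injective, the set has at most `m` elements. Otherwise let `P` be a colour class
with two distinct elements `s`, `s₁`. By the induction hypothesis the following exist: a complete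
multipartite copy `z` of `S \ P`; an independent copy `g` of `P`, far from `z`; a complete
multipartite copy `q` of `S \ P`, joined to `z` and to `g`; an independent copy `y` of `P`, far from
the copy of `S \ {s}` formed by `q` and `g`. Suppose that `h '' S` is dominating. Adding a vertex
`z a` to this last copy gives a copy of `S`, which is dominating, so `z a` is adjacent to all of
`y`. Hence `z` and `y` form a complete multipartite copy of `S`, but `g s₁` is far from it. -/
theorem far_nonempty_of_coloring (hm : G.IsDominationThreshold m) (hG : G.IsMEHomogeneous)
    (hc : G.HasCommonNeighbors) {ι κ : Type*} [DecidableEq κ] (c : ι → κ) (S : Finset ι)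
    (hcard : (S.image c).card ≤ m) (h : ι → V) (hinj : Set.InjOn h S)
    (hcol : ∀ a ∈ S, ∀ b ∈ S, G.Adj (h a) (h b) → c a ≠ c b) :
    (G.far (h '' S)).Nonempty := by
  classical
  have hV : Nonempty V := ⟨(hc ∅ Set.finite_empty).choose⟩
  induction S using Finset.strongInduction generalizing h with
  | H S ih =>
  by_contra hbad
  -- every other copy of `S` with at least as many edges is dominating, too
  have hdom : ∀ h' : ι → V, Set.InjOn h' S →
      (∀ a ∈ S, ∀ b ∈ S, c a ≠ c b → G.Adj (h' a) (h' b)) → ∀ v, v ∉ G.far (h' '' S) :=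
    fun h' hinj' hh' v hv => hbad (hG.far_nonempty_of_hom S.finite_toSet hinj hinj'
      (fun a ha b hb hab => hh' a ha b hb (hcol a ha b hb hab)) ⟨v, hv⟩)
  obtain ⟨s, hs, s₁, hs₁, hss₁, hcs⟩ : ∃ s ∈ S, ∃ s₁ ∈ S, s₁ ≠ s ∧ c s₁ = c s := by
    by_contra! hno
    have hcinj : Set.InjOn c S := fun a ha b hb hab => by_contra fun hne => hno b hb a ha hne hab
    refine hbad ?_
    rw [← Finset.coe_image]
    refine hm.far_nonempty _ ((Finset.card_image_le).trans ?_)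
    rwa [← Finset.card_image_of_injOn hcinj]
  -- `R` is the complement of the colour class `P` of `s`
  set R := S.filter fun a => c a ≠ c s with hR
  have hRS : R ⊂ S := Finset.filter_ssubset.2 ⟨s, hs, by simp⟩
  have hmemR : ∀ a ∈ S, c a ≠ c s → a ∈ R := fun a ha h => Finset.mem_filter.2 ⟨ha, h⟩
  have hcR : ∀ a ∈ R, c a ≠ c s := fun a ha => (Finset.mem_filter.1 ha).2
  have hcard' : ∀ S' ⊆ S, (S'.image c).card ≤ m := fun S' hS' =>
    (Finset.card_le_card (Finset.image_subset_image hS')).trans hcard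
  obtain ⟨z, hzinj, hz, -⟩ := hm.exists_multipartite hG hc R c Set.finite_empty
  obtain ⟨I, hIz, hI, hIk⟩ : ∃ I : Finset V, (I : Set V) ⊆ G.far (z '' R) ∧
      G.IsIndepSet (I : Set V) ∧ I.card = S.card := by
    rcases R.eq_empty_or_nonempty with hR0 | hR0
    · obtain ⟨I, hI, hIk, -⟩ := hm.exists_isIndepSet_adj hG hc Set.finite_empty S.card
      exact ⟨I, by simp [hR0, far], hI, hIk⟩
    · exact hm.exists_isIndepSet_far hG hc (R.finite_toSet.image z)
        ((Finset.coe_nonempty.2 hR0).image z)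
        (ih R hRS (hcard' R hRS.subset) z hzinj fun a ha b hb => (hz a ha b hb).1) S.card
  obtain ⟨g, hgI, hg⟩ := exists_injOn_of_card_le hIk.ge
  have hgz : ∀ a ∈ S, ∀ b ∈ R, g a ≠ z b ∧ ¬G.Adj (g a) (z b) := fun a ha b hb =>
    ⟨fun h => (hIz (hgI a ha)).1 ⟨b, hb, h.symm⟩, (hIz (hgI a ha)).2 _ ⟨b, hb, rfl⟩⟩
  have hgg : ∀ a ∈ S, ∀ b ∈ S, ¬G.Adj (g a) (g b) := fun a ha b hb h =>
    hI (hgI a ha) (hgI b hb) h.ne h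
  obtain ⟨q, hqinj, hq, hqD⟩ := hm.exists_multipartite hG hc R c
    ((R.finite_toSet.image z).union (S.finite_toSet.image g))
  have hqz : ∀ a ∈ R, ∀ b ∈ R, G.Adj (q a) (z b) := fun a ha b hb =>
    hqD a ha _ (Or.inl ⟨b, hb, rfl⟩)
  have hqg : ∀ a ∈ R, ∀ b ∈ S, G.Adj (q a) (g b) := fun a ha b hb =>
    hqD a ha _ (Or.inr ⟨b, hb, rfl⟩)
  -- `q` and `g` form a complete multipartite copy `p` of `S`
  set p : ι → V := fun a => if c a = c s then g a else q a with hp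
  have hpg : ∀ a, c a = c s → p a = g a := fun a ha => by simp [hp, ha]
  have hpq : ∀ a, c a ≠ c s → p a = q a := fun a ha => by simp [hp, ha]
  have hpinj : Set.InjOn p S := by
    intro a ha b hb hab
    by_cases hca : c a = c s <;> by_cases hcb : c b = c s
    · rw [hpg a hca, hpg b hcb] at hab
      exact hg ha hb hab
    · rw [hpg a hca, hpq b hcb] at hab
      exact absurd hab.symm (hqg b (hmemR b hb hcb) a ha).ne
    · rw [hpq a hca, hpg b hcb] at hab
      exact absurd hab (hqg a (hmemR a ha hca) b hb).ne
    · rw [hpq a hca, hpq b hcb] at hab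
      exact hqinj (hmemR a ha hca) (hmemR b hb hcb) hab
  have hpadj : ∀ a ∈ S, ∀ b ∈ S, G.Adj (p a) (p b) ↔ c a ≠ c b := by
    intro a ha b hb
    by_cases hca : c a = c s <;> by_cases hcb : c b = c s
    · rw [hpg a hca, hpg b hcb]
      exact iff_of_false (hgg a ha b hb) (by simp [hca, hcb])
    · rw [hpg a hca, hpq b hcb]
      exact iff_of_true (hqg b (hmemR b hb hcb) a ha).symm (by simpa [hca] using Ne.symm hcb)
    · rw [hpq a hca, hpg b hcb]
      exact iff_of_true (hqg a (hmemR a ha hca) b hb) (by simpa [hcb] using hca)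
    · rw [hpq a hca, hpq b hcb]
      exact hq a (hmemR a ha hca) b (hmemR b hb hcb)
  have hsub : ∀ a ∈ S.erase s, a ∈ S := fun a ha => Finset.mem_of_mem_erase ha
  have hs₁e : s₁ ∈ S.erase s := Finset.mem_erase.2 ⟨hss₁, hs₁⟩
  obtain ⟨J, hJp, hJ, hJk⟩ := hm.exists_isIndepSet_far hG hc ((S.erase s).finite_toSet.image p)
    ⟨p s₁, s₁, hs₁e, rfl⟩
    (ih (S.erase s) (Finset.erase_ssubset hs) (hcard' _ (Finset.erase_subset _ _)) p
      (hpinj.mono (Finset.coe_subset.2 (Finset.erase_subset _ _)))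
      fun a ha b hb => (hpadj a (hsub a ha) b (hsub b hb)).1) S.card
  obtain ⟨y, hyJ, hy⟩ := exists_injOn_of_card_le hJk.ge
  have hyp : ∀ a ∈ S, ∀ b ∈ S.erase s, y a ≠ p b ∧ ¬G.Adj (y a) (p b) := fun a ha b hb =>
    ⟨fun h => (hJp (hyJ a ha)).1 ⟨b, hb, h.symm⟩, (hJp (hyJ a ha)).2 _ ⟨b, hb, rfl⟩⟩
  have hRe : ∀ a ∈ R, a ∈ S.erase s := fun a ha =>
    Finset.mem_erase.2 ⟨fun h => hcR a ha (h ▸ rfl), hRS.subset ha⟩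
  have hyz : ∀ a ∈ S, ∀ b ∈ R, G.Adj (y a) (z b) := by
    intro a ha b hb
    have hne : y a ≠ z b := by
      intro h
      refine (hyp a ha b (hRe b hb)).2 ?_
      rw [h, hpq b (hcR b hb)]
      exact (hqz b hb b hb).symm
    by_contra hnadj
    have hpb : ∀ d ∈ S, d ≠ s → p d ≠ z b ∧ (c d ≠ c s → G.Adj (p d) (z b)) := by
      intro d hd hds
      by_cases hcd : c d = c s
      · rw [hpg d hcd]
        exact ⟨(hgz d hd b hb).1, fun h => absurd hcd h⟩
      · rw [hpq d hcd]
        exact ⟨(hqz d (hmemR d hd hcd) b hb).ne, fun _ => hqz d (hmemR d hd hcd) b hb⟩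
    refine hdom (Function.update p s (z b)) ?_ ?_ (y a) ⟨?_, ?_⟩
    · intro d hd e he hde
      by_cases hds : d = s <;> by_cases hes : e = s
      · rw [hds, hes]
      · subst hds
        simp only [Function.update_self, Function.update_of_ne hes] at hde
        exact absurd hde.symm (hpb e he hes).1
      · subst hes
        simp only [Function.update_self, Function.update_of_ne hds] at hde
        exact absurd hde (hpb d hd hds).1
      · simp only [Function.update_of_ne hds, Function.update_of_ne hes] at hde
        exact hpinj hd he hde
    · intro d hd e he hde
      by_cases hds : d = s <;> by_cases hes : e = s
      · exact absurd (by rw [hds, hes]) hde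
      · subst hds
        simp only [Function.update_self, Function.update_of_ne hes]
        exact ((hpb e he hes).2 hde.symm).symm
      · subst hes
        simp only [Function.update_self, Function.update_of_ne hds]
        exact (hpb d hd hds).2 hde
      · simp only [Function.update_of_ne hds, Function.update_of_ne hes]
        exact (hpadj d hd e he).2 hde
    · rintro ⟨d, hd, hda⟩
      by_cases hds : d = s
      · rw [hds, Function.update_self] at hda
        exact hne hda.symm
      · rw [Function.update_of_ne hds] at hda
        exact (hyp a ha d (Finset.mem_erase.2 ⟨hds, hd⟩)).1 hda.symm
    · rintro _ ⟨d, hd, rfl⟩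
      by_cases hds : d = s
      · rwa [hds, Function.update_self]
      · rw [Function.update_of_ne hds]
        exact (hyp a ha d (Finset.mem_erase.2 ⟨hds, hd⟩)).2
  -- now `z ∪ y` is a copy of `S` far from `g s₁`
  have hg₁ : ∀ a ∈ S, y a ≠ g s₁ ∧ ¬G.Adj (y a) (g s₁) := fun a ha => by
    simpa only [hpg s₁ hcs] using hyp a ha s₁ hs₁e
  refine hdom (fun a => if c a = c s then y a else z a) ?_ ?_ (g s₁) ⟨?_, ?_⟩
  · intro a ha b hb hab
    by_cases hca : c a = c s <;> by_cases hcb : c b = c s <;>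
      simp only [hca, hcb, if_true, if_false] at hab
    · exact hy ha hb hab
    · exact absurd hab (hyz a ha b (hmemR b hb hcb)).ne
    · exact absurd hab.symm (hyz b hb a (hmemR a ha hca)).ne
    · exact hzinj (hmemR a ha hca) (hmemR b hb hcb) hab
  · intro a ha b hb hab
    by_cases hca : c a = c s <;> by_cases hcb : c b = c s <;>
      simp only [hca, hcb, if_true, if_false]
    · exact absurd (hca.trans hcb.symm) hab
    · exact hyz a ha b (hmemR b hb hcb)
    · exact (hyz b hb a (hmemR a ha hca)).symm
    · exact (hz a (hmemR a ha hca) b (hmemR b hb hcb)).2 hab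
  · rintro ⟨a, ha, hag⟩
    by_cases hca : c a = c s <;> simp only [hca, if_true, if_false] at hag
    · exact (hg₁ a ha).1 hag
    · exact (hgz s₁ hs₁ a (hmemR a ha hca)).1 hag.symm
  · rintro _ ⟨a, ha, rfl⟩
    by_cases hca : c a = c s <;> simp only [hca, if_true, if_false]
    · exact fun h => (hg₁ a ha).2 h.symm
    · exact (hgz s₁ hs₁ a (hmemR a ha hca)).2

/-- Pairwise non-adjacent choices `w e ∈ G.far e` for `m`-sets `e` that pairwise intersect: each
`e` and the vertices chosen before can be coloured with the elements of `e`. -/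
theorem exists_transversal (hm : G.IsDominationThreshold m) (hG : G.IsMEHomogeneous)
    (hc : G.HasCommonNeighbors) (E : Finset (Finset V)) (hE : ∀ e ∈ E, e.card = m)
    (hint : ∀ e ∈ E, ∀ f ∈ E, ∃ x ∈ e, x ∈ f) :
    ∃ w : Finset V → V, (∀ e ∈ E, w e ∈ G.far (e : Set V)) ∧
      ∀ e ∈ E, ∀ f ∈ E, ¬G.Adj (w e) (w f) := by
  classical
  induction E using Finset.induction_on with
  | empty => exact ⟨fun _ => (hc ∅ Set.finite_empty).choose, by simp, by simp⟩
  | insert e E he ih =>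
    obtain ⟨w, hw, hww⟩ := ih (fun f hf => hE f (Finset.mem_insert_of_mem hf))
      fun f hf f' hf' => hint f (Finset.mem_insert_of_mem hf) f' (Finset.mem_insert_of_mem hf')
    have hcol : ∀ v : V, ∃ x, v ∈ e ∪ E.image w → x ∈ e ∧ (v ∈ e → x = v) ∧ ¬G.Adj v x := by
      intro v
      by_cases hve : v ∈ e
      · exact ⟨v, fun _ => ⟨hve, fun _ => rfl, G.irrefl⟩⟩
      by_cases hvE : v ∈ E.image w
      · obtain ⟨f, hf, rfl⟩ := Finset.mem_image.1 hvE
        obtain ⟨x, hxe, hxf⟩ := hint e (Finset.mem_insert_self _ _) f (Finset.mem_insert_of_mem hf)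
        exact ⟨x, fun _ => ⟨hxe, fun h => absurd h hve, (hw f hf).2 x hxf⟩⟩
      · exact ⟨v, fun h => ((Finset.mem_union.1 h).elim hve hvE).elim⟩
    choose c hce using hcol
    obtain ⟨v, hv⟩ := hm.far_nonempty_of_coloring hG hc c (e ∪ E.image w)
      ((Finset.card_le_card (Finset.image_subset_iff.2 fun a ha => (hce a ha).1)).trans
        (hE e (Finset.mem_insert_self _ _)).le) id (Set.injOn_id _)
      (by
        intro a ha b hb hab hcab
        simp only [id] at hab
        by_cases hae : a ∈ e
        · exact (hce b hb).2.2 (by rw [← hcab, (hce a ha).2.1 hae]; exact hab.symm)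
        by_cases hbe : b ∈ e
        · exact (hce a ha).2.2 (by rw [hcab, (hce b hb).2.1 hbe]; exact hab)
        obtain ⟨f, hf, rfl⟩ := Finset.mem_image.1 ((Finset.mem_union.1 ha).resolve_left hae)
        obtain ⟨f', hf', rfl⟩ := Finset.mem_image.1 ((Finset.mem_union.1 hb).resolve_left hbe)
        exact hww f hf f' hf' hab)
    rw [Set.image_id, Finset.coe_union] at hv
    have hvw : ∀ f ∈ E, ¬G.Adj v (w f) := fun f hf =>
      hv.2 _ (Or.inr (Finset.mem_coe.2 (Finset.mem_image_of_mem w hf)))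
    have hne : ∀ f ∈ E, f ≠ e := fun f hf h => he (h ▸ hf)
    refine ⟨Function.update w e v, ?_, ?_⟩
    · intro f hf
      rcases Finset.mem_insert.1 hf with rfl | hf
      · rw [Function.update_self]
        exact far_anti Set.subset_union_left hv
      · rw [Function.update_of_ne (hne f hf)]
        exact hw f hf
    · intro f hf f' hf'
      rcases Finset.mem_insert.1 hf with h | h <;> rcases Finset.mem_insert.1 hf' with h' | h'
      · rw [h, h']
        exact G.irrefl
      · rw [h, Function.update_self, Function.update_of_ne (hne f' h')]
        exact hvw f' h'
      · rw [h', Function.update_self, Function.update_of_ne (hne f h)]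
        exact fun hadj => hvw f h hadj.symm
      · rw [Function.update_of_ne (hne f h), Function.update_of_ne (hne f' h')]
        exact hww f h f' h'

/-- For `m ≥ 2`, take a clique `X` with `2 * m - 1` vertices, pairwise non-adjacent vertices
`w e ∈ G.far e` for the `m`-subsets `e` of `X`, and a common neighbour `p` of all these. A vertex
that is far from the star formed by `p` and the `w e` is adjacent to all of some `m`-subset
of `X` or to none of some `m`-subset, and either is impossible. -/
theorem eq_one (hm : G.IsDominationThreshold m) (hG : G.IsMEHomogeneous)
    (hc : G.HasCommonNeighbors) : m = 1 := by
  classical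
  by_contra hm1
  have hpos := hm.pos
  obtain ⟨z, hz, -⟩ := hc.exists_clique (Finset.range (2 * m - 1)) Set.finite_empty
  set X := (Finset.range (2 * m - 1)).image z with hX
  have hXcard : X.card = 2 * m - 1 := by
    rw [hX, Finset.card_image_of_injOn (injOn_of_adj hz), Finset.card_range]
  have hXcl : G.IsClique (X : Set V) := by
    rw [hX, Finset.coe_image]
    rintro _ ⟨a, ha, rfl⟩ _ ⟨b, hb, rfl⟩ hab
    exact hz a ha b hb fun h => hab (h ▸ rfl)
  have hclique : ∀ e ⊆ X, e.card = m → G.IsNClique m e := fun e he hem =>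
    ⟨hXcl.subset (Finset.coe_subset.2 he), hem⟩
  obtain ⟨w, hw, hww⟩ := hm.exists_transversal hG hc (X.powersetCard m)
    (fun e he => (Finset.mem_powersetCard.1 he).2)
    (by
      intro e he f hf
      rw [Finset.mem_powersetCard] at he hf
      by_contra! hdisj
      have h1 := Finset.card_union_of_disjoint (Finset.disjoint_left.2 hdisj)
      have h2 := Finset.card_le_card (Finset.union_subset he.1 hf.1)
      omega)
  set W := (X.powersetCard m).image w with hW
  obtain ⟨p, hp⟩ := hc (↑X ∪ ↑W) (X.finite_toSet.union W.finite_toSet)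
  have hpX : ∀ x ∈ X, G.Adj p x := fun x hx => hp x (Or.inl hx)
  obtain ⟨v, hv⟩ := hm.far_nonempty_of_coloring hG hc (fun a => decide (a = p)) (insert p W)
    ((Finset.card_le_univ _).trans (by rw [Fintype.card_bool]; omega)) id (Set.injOn_id _)
    (by
      intro a ha b hb hab hcab
      simp only [id] at hab
      rw [decide_eq_decide] at hcab
      by_cases hap : a = p
      · exact hab.ne (hap.trans (hcab.1 hap).symm)
      · obtain ⟨e, he, rfl⟩ := Finset.mem_image.1 ((Finset.mem_insert.1 ha).resolve_left hap)
        obtain ⟨f, hf, rfl⟩ := Finset.mem_image.1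
          ((Finset.mem_insert.1 hb).resolve_left fun h => hap (hcab.2 h))
        exact hww e he f hf hab)
  rw [Set.image_id, Finset.coe_insert] at hv
  have hvp : ¬G.Adj v p := hv.2 p (Or.inl rfl)
  have hvX : v ∉ X := fun h => hvp (hpX v h).symm
  have hsplit := Finset.card_filter_add_card_filter_not (s := X) (fun x => G.Adj v x)
  rcases le_or_gt m (X.filter fun x => G.Adj v x).card with hle | hlt
  · obtain ⟨e, he, hem⟩ := Finset.exists_subset_card_eq hle
    have heX : e ⊆ X := he.trans (Finset.filter_subset _ _)
    have heP : e ∈ X.powersetCard m := Finset.mem_powersetCard.2 ⟨heX, hem⟩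
    have hadj := hm.adj_of_mem_far (hclique e heX hem)
      (fun b hb => (Finset.mem_filter.1 (he hb)).2) (hw e heP)
    exact hv.2 (w e) (Or.inr (Finset.mem_coe.2 (Finset.mem_image_of_mem w heP))) hadj.symm
  · obtain ⟨e, he, hem⟩ : ∃ e ⊆ X.filter fun x => ¬G.Adj v x, e.card = m :=
      Finset.exists_subset_card_eq (by omega)
    have heX : e ⊆ X := he.trans (Finset.filter_subset _ _)
    exact hvp (hm.adj_of_mem_far (hclique e heX hem) (fun b hb => hpX b (heX hb))
      ⟨fun h => hvX (heX h), fun b hb => (Finset.mem_filter.1 (he hb)).2⟩)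

end IsDominationThreshold

/-- If some finite set is dominating, let `m + 1` be the least size of such a set; any clique of
that size is the image of a dominating set under a monomorphism. -/
theorem IsMEHomogeneous.exists_isDominationThreshold (hG : G.IsMEHomogeneous)
    (hnc : ∃ u v, u ≠ v ∧ ¬G.Adj u v) {T : Finset V}
    (hT : G.far (T : Set V) = ∅) : ∃ m, G.IsDominationThreshold m := by
  classical
  obtain ⟨u, u', huu, hadj⟩ := hnc
  have : Nonempty V := ⟨u⟩
  have hex : ∃ n, ∃ T : Finset V, T.card = n ∧ G.far (T : Set V) = ∅ := ⟨_, T, rfl, hT⟩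
  obtain ⟨B, hBn, hB⟩ := Nat.find_spec hex
  have hmin : ∀ T : Finset V, T.card < Nat.find hex → (G.far (T : Set V)).Nonempty := by
    intro T hT
    by_contra hne
    exact Nat.find_min hex hT ⟨T, rfl, Set.not_nonempty_iff_eq_empty.1 hne⟩
  have hcl : ∀ K : Finset V, G.IsNClique (Nat.find hex) K → G.far (K : Set V) = ∅ := by
    intro K hK
    obtain ⟨f, hfK, hf⟩ := exists_injOn_of_card_le (s := B) (t := K) (by rw [hBn, hK.card_eq])
    have him : f '' B = K := by
      rw [← Finset.coe_image, Finset.eq_of_subset_of_card_le (Finset.image_subset_iff.2 hfK)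
        (by rw [Finset.card_image_of_injOn hf, hBn, hK.card_eq])]
    by_contra hne
    have := hG.far_nonempty_of_hom B.finite_toSet (Set.injOn_id _) hf
      (fun a ha b hb hab => hK.isClique (hfK a ha) (hfK b hb) fun h => hab.ne (hf ha hb h))
      (by rw [him]; exact Set.nonempty_iff_ne_empty.2 hne)
    rw [Set.image_id, hB] at this
    exact Set.not_nonempty_empty this
  have h2 : 2 ≤ Nat.find hex := by
    by_contra! hlt
    rcases Nat.le_one_iff_eq_zero_or_eq_one.1 (Nat.lt_succ_iff.1 hlt) with h0 | h1
    · rw [h0, Finset.card_eq_zero] at hBn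
      subst hBn
      have : u ∈ G.far ((∅ : Finset V) : Set V) := by simp [far]
      rw [hB] at this
      exact this
    · have : u ∈ G.far (({u'} : Finset V) : Set V) := by simp [far, huu, hadj]
      rw [hcl {u'} (by rw [h1]; simp)] at this
      exact this
  refine ⟨Nat.find hex - 1, by omega, fun T hT => hmin T (by omega), fun K hK => hcl K ?_⟩
  rwa [Nat.sub_add_cancel (by omega)] at hK

/-! ### One-point extensions of homomorphisms -/

/-- The vertex `v` may be mapped to `F v`, where the epimorphism `F` extends the restriction of `f`
to a transversal of the fibres of `f` on the neighbours of `v`. -/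
theorem IsMEHomogeneous.exists_forth (hG : G.IsMEHomogeneous) (A : Finset V) {f : V → V}
    (hf : ∀ a ∈ A, ∀ b ∈ A, G.Adj a b → G.Adj (f a) (f b)) (v : V) :
    ∃ w, ∀ a ∈ A, G.Adj v a → G.Adj w (f a) := by
  obtain ⟨T, hT, hTbij⟩ := Set.exists_subset_bijOn {a | a ∈ A ∧ G.Adj v a} f
  have hTA : ∀ a ∈ T, a ∈ A := fun a ha => (hT ha).1
  obtain ⟨F, -, hF⟩ := hG.exists_epi (A.finite_toSet.subset hTA) hTbij.injOn
    fun a ha b hb => hf a (hTA a ha) b (hTA b hb)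
  refine ⟨F v, fun a ha hva => ?_⟩
  obtain ⟨t, ht, hta⟩ := hTbij.surjOn ⟨a, ⟨ha, hva⟩, rfl⟩
  rw [← hta, ← hF t ht]
  exact F.map_adj (hT ht).2

/-- If the image of `T` under a homomorphism is far from some vertex, then infinitely many vertices
are far from `T`. If `G` has common neighbours, it is enough that `T` is not dominating, and
the only dominating finite sets to be excluded occur when all edges dominate. -/
theorem IsMEHomogeneous.far_preimage_infinite [Infinite V] (hG : G.IsMEHomogeneous)
    (hnc : ∃ u v, u ≠ v ∧ ¬G.Adj u v) {T : Finset V} {f : V → V}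
    (hf : ∀ a ∈ T, ∀ b ∈ T, G.Adj a b → G.Adj (f a) (f b)) {w : V}
    (hw : ∀ a ∈ T, w ≠ f a ∧ ¬G.Adj (f a) w) : (G.far (T : Set V)).Infinite := by
  classical
  by_cases hc : G.HasCommonNeighbors
  swap
  · exact hG.far_infinite_of_not_hasCommonNeighbors hc T
  refine hG.far_infinite hc T.finite_toSet ?_
  by_contra hbad
  obtain ⟨m, hm⟩ := hG.exists_isDominationThreshold hnc (Set.not_nonempty_iff_eq_empty.1 hbad)
  obtain rfl := hm.eq_one hG hc
  -- edges are dominating, so the image of `T`, being far from `w`, contains no edge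
  have hind : ∀ a ∈ T, ∀ b ∈ T, ¬G.Adj a b := by
    intro a ha b hb hab
    have hfab := hf a ha b hb hab
    have hK : G.IsNClique 2 {f a, f b} := by
      refine ⟨?_, Finset.card_pair hfab.ne⟩
      rw [Finset.coe_pair]
      exact isClique_pair.2 fun _ => hfab
    have : w ∈ G.far (({f a, f b} : Finset V) : Set V) := by
      refine ⟨by simp [(hw a ha).1, (hw b hb).1], ?_⟩
      simpa [G.adj_comm w] using ⟨(hw a ha).2, (hw b hb).2⟩
    rw [hm.far_clique _ hK] at this
    exact this
  refine hbad ?_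
  simpa using hm.far_nonempty_of_coloring hG hc (fun _ => ()) T
    ((Finset.card_le_univ _).trans (by simp)) id (Set.injOn_id _)
    fun a ha b hb hab => absurd hab (hind a ha b hb)

/-- A vertex `v` that may be mapped to `w` is one that is far from the vertices of `A` whose images
are not adjacent to `w`. -/
theorem IsMEHomogeneous.exists_back [Infinite V] (hG : G.IsMEHomogeneous) (A : Finset V)
    {f : V → V} (hf : ∀ a ∈ A, ∀ b ∈ A, G.Adj a b → G.Adj (f a) (f b)) {w : V}
    (hw : ∀ a ∈ A, w ≠ f a) : ∃ v ∉ A, ∀ a ∈ A, G.Adj v a → G.Adj w (f a) := by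
  classical
  by_cases hnc : ∃ u v, u ≠ v ∧ ¬G.Adj u v
  · have hinf := hG.far_preimage_infinite hnc (T := A.filter fun a => ¬G.Adj (f a) w)
      (f := f) (w := w)
      (fun a ha b hb => hf a (Finset.mem_filter.1 ha).1 b (Finset.mem_filter.1 hb).1)
      fun a ha => ⟨hw a (Finset.mem_filter.1 ha).1, (Finset.mem_filter.1 ha).2⟩
    obtain ⟨v, hv, hvA⟩ := hinf.exists_notMem_finset A
    refine ⟨v, hvA, fun a ha hva => ?_⟩
    by_contra hadj
    exact hv.2 a (Finset.mem_coe.2 (Finset.mem_filter.2 ⟨ha, fun h => hadj h.symm⟩)) hva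
  · push Not at hnc
    obtain ⟨v, hv⟩ := Infinite.exists_notMem_finset A
    exact ⟨v, hv, fun a ha _ => hnc _ _ (hw a ha)⟩

/-! ### Back and forth -/

/-- A homomorphism from a finite induced subgraph to `G`, as a map on all vertices together with
a finite domain. -/
structure FiniteHom (G : SimpleGraph V) where
  dom : Finset V
  toFun : V → V
  map_adj : ∀ a ∈ dom, ∀ b ∈ dom, G.Adj a b → G.Adj (toFun a) (toFun b)

namespace FiniteHom

/-- `q` extends `p`; values outside the domains are irrelevant. -/
def Extends (q p : FiniteHom G) : Prop := p.dom ⊆ q.dom ∧ ∀ a ∈ p.dom, q.toFun a = p.toFun a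

theorem Extends.trans {p q r : FiniteHom G} (h : r.Extends q) (h' : q.Extends p) : r.Extends p :=
  ⟨h'.1.trans h.1, fun a ha => (h.2 a (h'.1 ha)).trans (h'.2 a ha)⟩

theorem Extends.refl (p : FiniteHom G) : p.Extends p := ⟨subset_rfl, fun _ _ => rfl⟩

theorem exists_extends_of_adj (p : FiniteHom G) {v w : V} (hv : v ∉ p.dom)
    (hvw : ∀ a ∈ p.dom, G.Adj v a → G.Adj w (p.toFun a)) :
    ∃ q : FiniteHom G, q.Extends p ∧ v ∈ q.dom ∧ q.toFun v = w := by
  classical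
  have hne : ∀ a ∈ p.dom, a ≠ v := fun a ha h => hv (h ▸ ha)
  refine ⟨⟨insert v p.dom, Function.update p.toFun v w, ?_⟩,
    ⟨Finset.subset_insert _ _, fun a ha => Function.update_of_ne (hne a ha) _ _⟩,
    Finset.mem_insert_self _ _, Function.update_self v w p.toFun⟩
  intro a ha b hb hab
  rcases Finset.mem_insert.1 ha with h | h <;> rcases Finset.mem_insert.1 hb with h' | h'
  · exact absurd (h.trans h'.symm) hab.ne
  · rw [h, Function.update_self, Function.update_of_ne (hne b h')]
    exact hvw b h' (h ▸ hab)
  · rw [h', Function.update_self, Function.update_of_ne (hne a h)]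
    exact (hvw a h (h' ▸ hab.symm)).symm
  · rw [Function.update_of_ne (hne a h), Function.update_of_ne (hne b h')]
    exact p.map_adj a h b h' hab

theorem exists_extends [Infinite V] (hG : G.IsMEHomogeneous) (p : FiniteHom G) (v : V) :
    ∃ q : FiniteHom G, q.Extends p ∧ v ∈ q.dom ∧ ∃ u ∈ q.dom, q.toFun u = v := by
  obtain ⟨q, hqp, hv⟩ : ∃ q : FiniteHom G, q.Extends p ∧ v ∈ q.dom := by
    by_cases hv : v ∈ p.dom
    · exact ⟨p, .refl p, hv⟩
    · obtain ⟨w, hw⟩ := hG.exists_forth p.dom p.map_adj v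
      obtain ⟨q, hqp, hvq, -⟩ := p.exists_extends_of_adj hv hw
      exact ⟨q, hqp, hvq⟩
  by_cases hq : ∃ u ∈ q.dom, q.toFun u = v
  · exact ⟨q, hqp, hv, hq⟩
  · push Not at hq
    obtain ⟨u, hu, huv⟩ := hG.exists_back q.dom q.map_adj fun a ha => (hq a ha).symm
    obtain ⟨r, hrq, hur, hruv⟩ := q.exists_extends_of_adj hu huv
    exact ⟨r, hrq.trans hqp, hrq.1 hv, u, hur, hruv⟩

theorem exists_epi [Countable V] [Infinite V] (hG : G.IsMEHomogeneous) (p : FiniteHom G) :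
    ∃ F : G →g G, Function.Surjective F ∧ ∀ a ∈ p.dom, F a = p.toFun a := by
  choose step hstep hdom hran using fun (q : FiniteHom G) (v : V) => q.exists_extends hG v
  obtain ⟨e, he⟩ := exists_surjective_nat V
  let s : ℕ → FiniteHom G := fun n => Nat.rec p (fun n q => step q (e n)) n
  have hmono : ∀ {m n}, m ≤ n → (s n).Extends (s m) := by
    intro m n hmn
    induction hmn with
    | refl => exact .refl _
    | step _ ih => exact (hstep _ _).trans ih
  choose k hk using he
  have hmem : ∀ v, v ∈ (s (k v + 1)).dom := fun v => by
    have h : e (k v) ∈ (s (k v + 1)).dom := hdom (s (k v)) (e (k v))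
    rwa [hk] at h
  have hval : ∀ n, ∀ v ∈ (s n).dom, (s (k v + 1)).toFun v = (s n).toFun v := by
    intro n v hv
    rw [← (hmono (le_max_left n (k v + 1))).2 v hv,
      ← (hmono (le_max_right n (k v + 1))).2 v (hmem v)]
  refine ⟨⟨fun v => (s (k v + 1)).toFun v, fun {a b} hab => ?_⟩, fun v => ?_, hval 0⟩
  · have ha := (hmono (le_max_left (k a + 1) (k b + 1))).1 (hmem a)
    have hb := (hmono (le_max_right (k a + 1) (k b + 1))).1 (hmem b)
    rw [hval _ a ha, hval _ b hb]
    exact (s _).map_adj a ha b hb hab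
  · obtain ⟨u, hu, huv⟩ := hran (s (k v)) (e (k v))
    exact ⟨u, (hval (k v + 1) u hu).trans (huv.trans (hk v))⟩

end FiniteHom

end SimpleGraph

theorem mainTheorem2 {V : Type*} [Countable V] [Infinite V] (G : SimpleGraph V) :
    G.IsMEHomogeneous ↔ G.IsHEHomogeneous := by
  classical
  refine ⟨fun hG A B hA _ f => ?_, fun hG A B hA hB f _ => hG A B hA hB f⟩
  obtain ⟨F, hF, hFf⟩ := SimpleGraph.FiniteHom.exists_epi hG
    ⟨hA.toFinset, fun a => if h : a ∈ A then f ⟨a, h⟩ else a, by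
      intro a ha b hb hab
      rw [Set.Finite.mem_toFinset] at ha hb
      simpa [ha, hb] using f.map_adj (show (G.induce A).Adj ⟨a, ha⟩ ⟨b, hb⟩ from hab)⟩
  exact ⟨F, hF, fun a => by simpa using hFf a (by simp)⟩
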